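/- Corollary 4.8. An array is a finite family of rows of equal length, repetitions of rows being allowed. For integers $q \ge p \ge k \ge 1$, a $(q,p)$-alphabet reduction pair of arrays of strength $k$ is a pair $(Q,P)$ of arrays with $q$ columns on the symbol set $\{0,\ldots,q-1\}$ such that: $Q$ contains the row $0\,1\,\ldots\,q-1$ at least once; each row of $P$ involves at most $p$ distinct symbols; and, for any $k$ columns, the subarrays of $Q$ and $P$ formed by these columns coincide up to the order of their rows. A $(q,p)$-cover pair of arrays of strength $k$ is a pair $(N,D)$ of arrays with $q$ columns on the symbol set $\{0,1\}$ such that: $N$ contains the row $1\,1\,\ldots\,1$ at least once; each row of $D$ has at most $p$ non-zero coordinates; and, for any $k$ columns, the subarrays of $N$ and $D$ formed by these columns coincide up to the order of their rows. Let $\gamma(q,p,k)$ be the highest ratio, over all $(q,p)$-alphabet reduction pairs $(Q,P)$ of strength $k$, of the number of occurrences of $0\,1\,\ldots\,q-1$ in $Q$ to the number of rows of $P$. Let $\delta(q,p,k)$ be the highest ratio, over all $(q,p)$-cover pairs $(N,D)$ of strength $k$, of the number of occurrences of $1\,1\,\ldots\,1$ in $N$ to the number of rows of $D$. Let $k \ge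 1$, $p \ge k$ and $q > p$ be integers such that $p = k$ or $k \in \{1,2\}$. Then both highest ratios are attained, $\gamma(q,p,k) = \delta(q,p,k)$, and this common value is equal to $$\frac{2}{1 + \sum_{i=0}^{k} \binom{q}{i}\binom{q-i-1}{k-i}} \quad\text{if } p = k,$$ $$\frac{p}{q} \quad\text{if } k = 1,$$ $$\frac{\lceil p/2\rceil\,\lfloor p/2\rfloor}{(q-\lceil p/2\rceil)(q-\lfloor p/2\rfloor)} \quad\text{if } k = 2.$$ -/

import Mathlib

open Finset

/-- An array with `R` rows and `n` columns on the symbol set `α`;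
`M r` is the row of index `r` and `M r j` its coefficient in column `j`. -/
abbrev SymbolArray (R n : ℕ) (α : Type*) := Fin R → Fin n → α

/-- The array extracted from `M` by keeping the columns in `J` only, up to the order of its rows,
that is, the multiset of the rows of `M` restricted to `J`. -/
def SymbolArray.extract {R n : ℕ} {α : Type*} (M : SymbolArray R n α) (J : Finset (Fin n)) :
    Multiset (J → α) :=
  (univ : Finset (Fin R)).val.map (fun r (j : J) => M r j)

/-- The condition `(k_=)`: extracting any `k` columns from `M`, and the same `k` columns from `M'`,
gives the same array up to the order of the rows. -/
def SameExtractions {R S n : ℕ} {α : Type*} (k : ℕ)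
    (M : SymbolArray R n α) (M' : SymbolArray S n α) : Prop :=
  ∀ J : Finset (Fin n), #J = k → M.extract J = M'.extract J

/-- The number of occurrences of the row `u` in the array `M`. -/
def SymbolArray.occurrences {R n : ℕ} {α : Type*} [DecidableEq α]
    (M : SymbolArray R n α) (u : Fin n → α) : ℕ :=
  #{r : Fin R | M r = u}

/-- `(Q, P)` is a `(q, p)`-alphabet reduction pair of arrays of strength `k`. The symbol set
`{0, …, q - 1}` is `Fin q`, which also indexes the columns: the row `0 1 … q - 1` is the
identity map. -/
structure IsARPA (q p k : ℕ) {R S : ℕ}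
    (Q : SymbolArray R q (Fin q)) (P : SymbolArray S q (Fin q)) : Prop where
  /-- `Q` contains at least one occurrence of the row `0 1 … q - 1`. -/
  exists_row : ∃ r, Q r = fun j => j
  /-- Each row of `P` involves at most `p` distinct symbols. -/
  card_symbols_le : ∀ r, #(univ.image (P r)) ≤ p
  same : SameExtractions k Q P

/-- `(N, D)` is a `(ν, d)`-cover pair of arrays of strength `k`. -/
structure IsCPA (ν d k : ℕ) {R S : ℕ}
    (N : SymbolArray R ν (Fin 2)) (D : SymbolArray S ν (Fin 2)) : Prop where
  /-- `N` contains at least one occurrence of the row `1 1 … 1`. -/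
  exists_row : ∃ r, N r = fun _ => 1
  /-- Each row of `D` has at most `d` non-zero coordinates. -/
  card_nonzero_le : ∀ r, #{j | D r j ≠ 0} ≤ d
  same : SameExtractions k N D

/-- The ratios `R*(Q, P) / R(Q, P)` over all `(q, p)`-alphabet reduction pairs of arrays `(Q, P)`
of strength `k`, where `R*` is the number of occurrences of `0 1 … q - 1` in `Q`, and `R` the number
of rows of `P`. -/
def arpaRatios (q p k : ℕ) : Set ℝ :=
  {x | ∃ (R S : ℕ) (Q : SymbolArray R q (Fin q)) (P : SymbolArray S q (Fin q)),
    IsARPA q p k Q P ∧ x = (Q.occurrences (fun j => j) : ℝ) / (S : ℝ)}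

/-- The ratios `R*(N, D) / R(N, D)` over all `(ν, d)`-cover pairs of arrays `(N, D)` of
strength `k`, where `R*` is the number of occurrences of `1 1 … 1` in `N`, and `R` the number of
rows of `D`. -/
def cpaRatios (ν d k : ℕ) : Set ℝ :=
  {x | ∃ (R S : ℕ) (N : SymbolArray R ν (Fin 2)) (D : SymbolArray S ν (Fin 2)),
    IsCPA ν d k N D ∧ x = (N.occurrences (fun _ => 1) : ℝ) / (S : ℝ)}

/-- `γ(q, p, k)`: the highest ratio reached by a `(q, p)`-alphabet reduction pair of arrays of
strength `k`. -/
noncomputable def arpaGamma (q p k : ℕ) : ℝ := sSup (arpaRatios q p k)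

/-- `δ(ν, d, k)`: the highest ratio reached by a `(ν, d)`-cover pair of arrays of strength `k`. -/
noncomputable def cpaDelta (ν d k : ℕ) : ℝ := sSup (cpaRatios ν d k)

/-!
A function `w` on `{0, …, q}` whose `(k + 1)`-st difference vanishes is a combination of binomial
coefficients `y.choose i` with `i ≤ k`. Hence, in a cover pair `(N, D)` of strength `k`, the values
of `w` at the numbers of non-zero coordinates of the rows have the same sum over `N` and over `D`.
If moreover `w ≥ 0`, and `w ≤ B` on `{0, …, p}`, this bounds the ratio by `B / w q`. The weights are
`1 + T` where `T` interpolates alternating signs at `0, …, k` if `p = k`, the identity if `k = 1`,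
and `(y - ⌈p/2⌉) (y - ⌊p/2⌋)` if `k = 2`.

Replacing each coefficient by `1` if it is the index of its column, and by `0` otherwise, turns an
alphabet reduction pair into a cover pair with the same ratio. It thus suffices to reach the three
bounds by alphabet reduction pairs: for `p = k` these are built by adding the columns one at a time,
for `k = 1` they are cyclic arrays, and for `k = 2` they are obtained by averaging a pair of arrays
over the permutations of all the columns but one.
-/

open scoped fwdDiff

section Agreement

variable {ι α β : Type*}

/-- The arrays with rows `A` and `B`, restricted to the columns in `J`, coincide up to the order of
their rows. Unlike in `SameExtractions`, arrays are multisets of rows here, so that they can be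
added, scaled and transformed row by row, and any type may index the columns. -/
def AgreeOn (J : Finset ι) (A B : Multiset (ι → α)) : Prop :=
  A.map J.restrict = B.map J.restrict

namespace AgreeOn

variable {J K : Finset ι} {A B C D : Multiset (ι → α)}

theorem map_eq (h : AgreeOn J A B) {g : (ι → α) → β} (hg : DependsOn g (J : Set ι)) :
    A.map g = B.map g := by
  rw [AgreeOn, ← Multiset.rel_eq, Multiset.rel_map] at h
  rw [← Multiset.rel_eq, Multiset.rel_map]
  exact h.mono fun f _ f' _ hff' => hg fun j hj => congrFun hff' ⟨j, hj⟩

theorem mono (h : AgreeOn K A B) (hJK : J ⊆ K) : AgreeOn J A B :=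
  h.map_eq (J.dependsOn_restrict.mono (coe_subset.2 hJK))

theorem add (h : AgreeOn J A B) (h' : AgreeOn J C D) : AgreeOn J (A + C) (B + D) := by
  simp only [AgreeOn, Multiset.map_add] at *
  rw [h, h']

theorem add_left_cancel (h : AgreeOn J (C + A) (C + B)) : AgreeOn J A B := by
  simp only [AgreeOn, Multiset.map_add] at *
  exact _root_.add_left_cancel h

theorem map (h : AgreeOn K A B) {u : (ι → α) → ι → β}
    (hu : ∀ j ∈ J, DependsOn (u · j) (K : Set ι)) : AgreeOn J (A.map u) (B.map u) := by
  simp only [AgreeOn, Multiset.map_map]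
  exact h.map_eq fun f f' hff' => funext fun j => hu j j.2 hff'

theorem card_eq (h : AgreeOn J A B) : Multiset.card A = Multiset.card B := by
  simpa using congrArg Multiset.card h

end AgreeOn

end Agreement

namespace SymbolArray

variable {R n : ℕ} {α : Type*}

/-- The multiset of the rows of an array, which forgets their order. -/
def rows (M : SymbolArray R n α) : Multiset (Fin n → α) :=
  (univ : Finset (Fin R)).val.map M

theorem exists_rows_eq (A : Multiset (Fin n → α)) :
    ∃ M : SymbolArray (Multiset.card A) n α, M.rows = A := by
  induction A using Quotient.inductionOn with | _ l
  exact ⟨l.get, (Fin.univ_val_map l.get).trans (congrArg _ l.ofFn_get)⟩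

theorem occurrences_eq_count [DecidableEq α] (M : SymbolArray R n α) (u : Fin n → α) :
    M.occurrences u = M.rows.count u := by
  simp only [occurrences, rows, Multiset.count_map, card_def, filter_val, eq_comm]

end SymbolArray

theorem newton_expansion {G : Type*} [AddCommGroup G] {k : ℕ} {w : ℕ → G}
    (hw : (Δ_[1])^[k + 1] w = 0) (x : ℕ) :
    w x = ∑ i ∈ range (k + 1), x.choose i • (Δ_[1])^[i] w 0 := by
  have hw' (i : ℕ) (hi : k + 1 ≤ i) : (Δ_[1])^[i] w = 0 := by
    obtain ⟨m, rfl⟩ := Nat.exists_eq_add_of_le' hi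
    rw [Function.iterate_add_apply, hw]
    exact Function.iterate_fixed (fwdDiff_const 1 0) m
  have hshift := shift_eq_sum_fwdDiff_iter 1 w x 0
  rw [zero_add, smul_eq_mul, mul_one] at hshift
  rw [hshift]
  refine sum_congr_of_eq_on_inter (fun i _ hi => ?_) (fun i _ hi => ?_) fun _ _ _ => rfl
  · rw [hw' i (not_lt.1 (mt mem_range.2 hi)), Pi.zero_apply, smul_zero]
  · rw [Nat.choose_eq_zero_of_lt (not_le.1 (mt mem_range_succ_iff.2 hi)), zero_smul]

namespace SameExtractions

variable {R S n k : ℕ} {α β : Type*} {M : SymbolArray R n α} {M' : SymbolArray S n α}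

theorem iff_agreeOn_rows :
    SameExtractions k M M' ↔ ∀ J : Finset (Fin n), #J = k → AgreeOn J M.rows M'.rows := by
  simp only [SameExtractions, SymbolArray.extract, AgreeOn, SymbolArray.rows, Multiset.map_map]
  rfl

theorem map_columns (h : SameExtractions k M M') (g : Fin n → α → β) :
    SameExtractions k (fun r j => g j (M r j)) (fun r j => g j (M' r j)) := by
  intro J hJ
  simpa only [SymbolArray.extract, Multiset.map_map, Function.comp_def] using
    congrArg (Multiset.map fun (v : J → α) (j : J) => g j (v j)) (h J hJ)

theorem sum_eq [AddCommMonoid β] (h : SameExtractions k M M') (hkn : k ≤ n) {J : Finset (Fin n)}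
    (hJ : #J ≤ k) {g : (Fin n → α) → β} (hg : DependsOn g (J : Set (Fin n))) :
    ∑ r, g (M r) = ∑ r, g (M' r) := by
  obtain ⟨K, hJK, -, hK⟩ := exists_subsuperset_card_eq (subset_univ J) hJ (by simpa using hkn)
  have hrows := (((iff_agreeOn_rows.1 h K hK).mono hJK).map_eq hg)
  simp only [SymbolArray.rows, Multiset.map_map] at hrows
  exact congrArg Multiset.sum hrows

theorem card_eq (h : SameExtractions k M M') (hkn : k ≤ n) : R = S := by
  simpa using h.sum_eq hkn (J := ∅) (by simp) (g := fun _ => (1 : ℕ)) (fun _ _ _ => rfl)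

theorem sum_choose_eq (h : SameExtractions k M M') (hkn : k ≤ n) {i : ℕ} (hi : i ≤ k)
    (A : α → Prop) [DecidablePred A] :
    ∑ r, (#{j | A (M r j)}).choose i = ∑ r, (#{j | A (M' r j)}).choose i := by
  have choose_eq (f : Fin n → α) : (#{j | A (f j)}).choose i =
      ∑ J ∈ powersetCard i univ, if ∀ j ∈ J, A (f j) then 1 else 0 := by
    rw [← card_powersetCard, sum_boole, Nat.cast_id]
    congr 1
    ext J
    simp [mem_powersetCard, subset_iff, and_comm]
  simp only [choose_eq]
  rw [sum_comm, sum_comm (s := univ (α := Fin S))]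
  refine sum_congr rfl fun J hJ => h.sum_eq hkn ((mem_powersetCard.1 hJ).2.trans_le hi)
    (g := fun f => if ∀ j ∈ J, A (f j) then 1 else 0) fun f f' hff' => ?_
  exact if_congr (forall₂_congr fun j hj => by rw [hff' j hj]) rfl rfl

theorem sum_weight_eq {G : Type*} [AddCommGroup G] (h : SameExtractions k M M') (hkn : k ≤ n)
    {w : ℕ → G} (hw : (Δ_[1])^[k + 1] w = 0) (A : α → Prop) [DecidablePred A] :
    ∑ r, w #{j | A (M r j)} = ∑ r, w #{j | A (M' r j)} := by
  simp only [fun x => newton_expansion hw x]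
  rw [sum_comm, sum_comm (s := univ (α := Fin S))]
  refine sum_congr rfl fun i hi => ?_
  rw [← sum_smul, ← sum_smul, h.sum_choose_eq hkn (mem_range_succ_iff.1 hi) A]

end SameExtractions

theorem isCPA_of_isARPA {q p k R S : ℕ} {Q : SymbolArray R q (Fin q)} {P : SymbolArray S q (Fin q)}
    (h : IsARPA q p k Q P) :
    IsCPA q p k (fun r j => if Q r j = j then (1 : Fin 2) else 0)
      (fun r j => if P r j = j then 1 else 0) where
  exists_row := h.exists_row.imp fun r hr => by simp [hr]
  card_nonzero_le r := by
    refine le_trans (card_le_card fun j hj => ?_) (h.card_symbols_le r)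
    exact mem_image.2 ⟨j, mem_univ _, by simpa using hj⟩
  same := h.same.map_columns fun j x => if x = j then 1 else 0

theorem arpaRatios_subset_cpaRatios (q p k : ℕ) : arpaRatios q p k ⊆ cpaRatios q p k := by
  rintro x ⟨R, S, Q, P, h, rfl⟩
  refine ⟨R, S, _, _, isCPA_of_isARPA h, ?_⟩
  simp [SymbolArray.occurrences, funext_iff]

theorem ratio_mem_arpaRatios_of_multiset {q p k : ℕ} {Q P : Multiset (Fin q → Fin q)}
    (hid : id ∈ Q) (hP : ∀ f ∈ P, #(univ.image f) ≤ p)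
    (hsame : ∀ J : Finset (Fin q), #J = k → AgreeOn J Q P) :
    (Q.count id : ℝ) / (Multiset.card P : ℝ) ∈ arpaRatios q p k := by
  obtain ⟨M, hM⟩ := SymbolArray.exists_rows_eq Q
  obtain ⟨M', hM'⟩ := SymbolArray.exists_rows_eq P
  refine ⟨_, _, M, M', ⟨?_, fun r => hP _ ?_, ?_⟩, ?_⟩
  · obtain ⟨r, -, hr⟩ := Multiset.mem_map.1 (hM ▸ hid)
    exact ⟨r, hr⟩
  · exact hM' ▸ Multiset.mem_map_of_mem M' (mem_univ r)
  · exact SameExtractions.iff_agreeOn_rows.2 (by rwa [hM, hM'])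
  · rw [SymbolArray.occurrences_eq_count]
    rw [hM]
    rfl

/-- Weak duality: `w` is a feasible solution of the dual of the linear program whose optimal value
is `δ(n, d, k)`. -/
theorem le_div_of_mem_cpaRatios {n d k : ℕ} (hkn : k ≤ n) {w : ℕ → ℝ} {B x : ℝ}
    (hw : (Δ_[1])^[k + 1] w = 0) (h0 : ∀ y ≤ n, 0 ≤ w y) (hB : ∀ y ≤ d, w y ≤ B)
    (hn : 0 < w n) (hx : x ∈ cpaRatios n d k) : x ≤ B / w n := by
  obtain ⟨R, S, N, D, h, rfl⟩ := hx
  obtain ⟨r₀, -⟩ := h.exists_row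
  have hS : 0 < S := h.same.card_eq hkn ▸ r₀.pos
  rw [div_le_div_iff₀ (by exact_mod_cast hS) hn]
  calc (N.occurrences (fun _ => 1) : ℝ) * w n
      = ∑ r with N r = fun _ => 1, w #{j | N r j ≠ 0} := by
        rw [SymbolArray.occurrences, ← nsmul_eq_mul, ← sum_const]
        refine sum_congr rfl fun r hr => ?_
        simp [(mem_filter.1 hr).2]
    _ ≤ ∑ r, w #{j | N r j ≠ 0} :=
        sum_le_sum_of_subset_of_nonneg (subset_univ _) fun r _ _ =>
          h0 _ ((card_le_univ _).trans_eq (Fintype.card_fin n))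
    _ = ∑ r, w #{j | D r j ≠ 0} := h.same.sum_weight_eq hkn hw (· ≠ 0)
    _ ≤ ∑ _r : Fin S, B := sum_le_sum fun r _ => hB _ (h.card_nonzero_le r)
    _ = B * S := by simp [mul_comm]

theorem isGreatest_of_attained {q p k : ℕ} {V : ℝ} (hub : ∀ x ∈ cpaRatios q p k, x ≤ V)
    (hV : ∃ x ∈ arpaRatios q p k, V ≤ x) :
    IsGreatest (arpaRatios q p k) V ∧ IsGreatest (cpaRatios q p k) V := by
  obtain ⟨x, hx, hVx⟩ := hV
  have hx' := arpaRatios_subset_cpaRatios q p k hx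
  obtain rfl : x = V := le_antisymm (hub x hx') hVx
  exact ⟨⟨hx, fun y hy => hub y (arpaRatios_subset_cpaRatios q p k hy)⟩, hx', hub⟩

section DualWeights

/-- The sum of the absolute values at `q` of the Lagrange basis polynomials for the nodes
`0, …, k`, where `k ≤ q`. At `q = k` the truncated subtraction `q - i - 1` is harmless: the sum
is `1`, as it should be. -/
def lebesgueSum (q k : ℕ) : ℕ :=
  ∑ i ∈ range (k + 1), q.choose i * (q - i - 1).choose (k - i)

theorem lebesgueSum_zero_right (q : ℕ) : lebesgueSum q 0 = 1 := by
  simp [lebesgueSum]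

theorem lebesgueSum_self (k : ℕ) : lebesgueSum k k = 1 := by
  rw [lebesgueSum, sum_range_succ, sum_eq_zero, zero_add]
  · simp
  · intro i hi
    rw [mem_range] at hi
    rw [Nat.choose_eq_zero_of_lt (by lia : k - i - 1 < k - i), mul_zero]

theorem lebesgueSum_succ_succ {q k : ℕ} (hkq : k < q) :
    lebesgueSum (q + 1) (k + 1) = lebesgueSum q (k + 1) + 2 * lebesgueSum q k := by
  have pascal_left : lebesgueSum (q + 1) (k + 1) = lebesgueSum q k +
      ∑ i ∈ range (k + 2), q.choose i * (q - i).choose (k + 1 - i) := by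
    rw [lebesgueSum, sum_range_succ', sum_range_succ' _ (k + 1), ← add_assoc, lebesgueSum,
      ← sum_add_distrib]
    congr 1
    · refine sum_congr rfl fun i _ => ?_
      rw [Nat.choose_succ_succ, Nat.add_sub_add_right, Nat.add_sub_add_right, add_mul, Nat.sub_sub]
    · simp
  have pascal_right : ∑ i ∈ range (k + 2), q.choose i * (q - i).choose (k + 1 - i) =
      lebesgueSum q (k + 1) + lebesgueSum q k := by
    rw [lebesgueSum, sum_range_succ, sum_range_succ _ (k + 1), lebesgueSum, add_right_comm,
      ← sum_add_distrib]
    congr 1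
    · refine sum_congr rfl fun i hi => ?_
      rw [mem_range] at hi
      have hqi : q - i = q - i - 1 + 1 := by lia
      have hki : k + 1 - i = k - i + 1 := by lia
      rw [← mul_add, hki, add_comm ((q - i - 1).choose _), ← Nat.choose_succ_succ',
        ← hqi]
    · simp
  lia

/-- The polynomial function of degree `k` with values `(-1) ^ (k - x)` at `x = 0, …, k`. Beyond
these nodes, the terms of the Lagrange interpolation formula are nonnegative, hence the
`lebesgueSum`. -/
def alternatingPoly (k x : ℕ) : ℝ :=
  if x < k then (-1) ^ (k - x) else lebesgueSum x k

theorem alternatingPoly_of_le {k x : ℕ} (hx : x ≤ k) : alternatingPoly k x = (-1) ^ (k - x) := by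
  obtain hx | rfl := hx.lt_or_eq
  · exact if_pos hx
  · simp [alternatingPoly, lebesgueSum_self]

theorem alternatingPoly_of_ge {k x : ℕ} (hx : k ≤ x) : alternatingPoly k x = lebesgueSum x k :=
  if_neg hx.not_gt

theorem neg_one_le_alternatingPoly (k x : ℕ) : -1 ≤ alternatingPoly k x := by
  rcases le_total x k with hx | hx
  · rw [alternatingPoly_of_le hx]
    rcases neg_one_pow_eq_or ℝ (k - x) with h | h <;> simp [h]
  · rw [alternatingPoly_of_ge hx]
    linarith [(lebesgueSum x k).cast_nonneg (α := ℝ)]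

theorem alternatingPoly_le_one {k x : ℕ} (hx : x ≤ k) : alternatingPoly k x ≤ 1 := by
  rw [alternatingPoly_of_le hx]
  rcases neg_one_pow_eq_or ℝ (k - x) with h | h <;> simp [h]

theorem fwdDiff_alternatingPoly_succ (k : ℕ) :
    Δ_[1] (alternatingPoly (k + 1)) = 2 • alternatingPoly k := by
  ext x
  rw [fwdDiff, Pi.smul_apply, nsmul_eq_mul]
  rcases lt_or_ge k x with hx | hx
  · rw [alternatingPoly_of_ge (by lia), alternatingPoly_of_ge (Nat.succ_le_of_lt hx),
      alternatingPoly_of_ge hx.le, lebesgueSum_succ_succ hx]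
    push_cast
    ring
  · rw [alternatingPoly_of_le (by lia), alternatingPoly_of_le (by lia), alternatingPoly_of_le hx,
      Nat.add_sub_add_right, Nat.succ_sub hx, pow_succ]
    ring

theorem fwdDiff_iter_alternatingPoly (k : ℕ) : (Δ_[1])^[k + 1] (alternatingPoly k) = 0 := by
  induction k with
  | zero =>
    ext x
    simp [fwdDiff, alternatingPoly_of_ge, lebesgueSum_zero_right]
  | succ k ih =>
    rw [Function.iterate_succ_apply, fwdDiff_alternatingPoly_succ, fwdDiff_iter_const_smul, ih,
      smul_zero]

theorem le_of_mem_cpaRatios_self {k q : ℕ} (hkq : k ≤ q) {x : ℝ} (hx : x ∈ cpaRatios q k k) :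
    x ≤ 2 / (1 + lebesgueSum q k) := by
  rw [← alternatingPoly_of_ge hkq]
  refine le_div_of_mem_cpaRatios hkq (w := fun y => 1 + alternatingPoly k y) ?_ (fun y _ => ?_)
    (fun y hy => ?_) ?_ hx
  · rw [Function.iterate_succ_apply, show Δ_[1] (fun y => 1 + alternatingPoly k y) =
      Δ_[1] (alternatingPoly k) from funext fun y => add_sub_add_left_eq_sub ..,
      ← Function.iterate_succ_apply, fwdDiff_iter_alternatingPoly]
  · linarith [neg_one_le_alternatingPoly k y]
  · linarith [alternatingPoly_le_one hy]
  · rw [alternatingPoly_of_ge hkq]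
    positivity

theorem le_of_mem_cpaRatios_one {p q : ℕ} (hq : 0 < q) {x : ℝ} (hx : x ∈ cpaRatios q p 1) :
    x ≤ p / q := by
  refine le_div_of_mem_cpaRatios hq (w := Nat.cast) ?_ (fun y _ => y.cast_nonneg)
    (fun y hy => by exact_mod_cast hy) (by exact_mod_cast hq) hx
  ext y
  simp [fwdDiff]

theorem le_of_mem_cpaRatios_two {a b q : ℕ} (hab : a = b ∨ a = b + 1) (h : 2 ≤ q)
    (hq : a + b < q) {x : ℝ} (hx : x ∈ cpaRatios q (a + b) 2) :
    x ≤ a * b / ((q - a) * (q - b)) := by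
  have ha : (a : ℝ) < q := by exact_mod_cast (by lia : a < q)
  have hb : (b : ℝ) < q := by exact_mod_cast (by lia : b < q)
  refine le_div_of_mem_cpaRatios h (w := fun y => ((y : ℝ) - a) * (y - b)) ?_ (fun y _ => ?_)
    (fun y hy => ?_) (mul_pos (sub_pos.2 ha) (sub_pos.2 hb)) hx
  · ext y
    simp only [Function.iterate_succ_apply, Function.iterate_zero_apply, fwdDiff, Pi.zero_apply]
    push_cast
    ring
  · -- No integer lies strictly between the roots `b` and `a`.
    have : (0 : ℤ) ≤ (y - a) * (y - b) := by
      rcases hab with rfl | rfl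
      · exact mul_self_nonneg _
      · rcases le_or_gt y b with h | h <;> push_cast <;> nlinarith
    exact_mod_cast this
  · have hy' : (y : ℝ) ≤ a + b := by exact_mod_cast hy
    nlinarith [mul_nonneg y.cast_nonneg (sub_nonneg.2 hy')]

end DualWeights

theorem exists_mem_arpaRatios_one {p q : ℕ} (hp : 0 < p) (hpq : p ≤ q) :
    ∃ x ∈ arpaRatios q p 1, (p : ℝ) / q ≤ x := by
  have : NeZero q := ⟨(hp.trans_le hpq).ne'⟩
  have card_lt : #{t : Fin q | (t : ℕ) < p} = p := by
    rw [Fin.card_filter_val_lt, min_eq_right hpq]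
  -- In every column `j`, the rows `t` of `Q` and `j - t` of `P` have the same symbol.
  let Q (t j : Fin q) : Fin q := if (t : ℕ) < p then j else j - t
  let P (r j : Fin q) : Fin q := if ((j - r : Fin q) : ℕ) < p then j else r
  have hcount : p ≤ (univ.val.map Q).count id := by
    rw [Multiset.count_map, ← filter_val, ← card_def]
    conv_lhs => rw [← card_lt]
    refine card_le_card (monotone_filter_right _ fun t _ ht => ?_)
    exact (funext fun j => (if_pos ht).symm :)
  have hsymbols (r : Fin q) : #(univ.image (P r)) ≤ p := by
    have hsub : univ.image (P r) ⊆ ({t | (t : ℕ) < p} : Finset (Fin q)).map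
        (Equiv.addRight r).toEmbedding := by
      refine image_subset_iff.2 fun j _ => ?_
      by_cases hj : ((j - r : Fin q) : ℕ) < p <;> simp [P, hj, hp, ← sub_eq_add_neg]
    simpa only [card_map, card_lt] using card_le_card hsub
  have hagree (j : Fin q) : AgreeOn {j} (univ.val.map Q) (univ.val.map P) := by
    rw [AgreeOn, Multiset.map_map, Multiset.map_map]
    conv_rhs => rw [← Multiset.map_univ_val_equiv (Equiv.subLeft j), Multiset.map_map]
    refine Multiset.map_congr rfl fun t _ => funext fun ⟨i, hi⟩ => ?_
    obtain rfl := mem_singleton.1 hi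
    simp [Q, P]
  have hid := Multiset.count_pos.1 (hp.trans_le hcount)
  refine ⟨_, ratio_mem_arpaRatios_of_multiset (P := univ.val.map P) hid
    (Multiset.forall_mem_map_iff.2 fun r _ => hsymbols r) fun J hJ => ?_, ?_⟩
  · obtain ⟨j, rfl⟩ := card_eq_one.1 hJ
    exact hagree j
  · rw [Multiset.card_map, card_val, card_fin]
    gcongr

section StrengthEqualsSymbols

variable {ι α : Type*} [DecidableEq ι]

theorem image_insert_update [DecidableEq α] {S : Finset ι} {z : ι} (hz : z ∉ S) (f : ι → α)
    (y : α) : (insert z S).image (Function.update f z y) = insert y (S.image f) := by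
  rw [image_insert, Function.update_self]
  congr 1
  exact image_congr fun j hj => Function.update_of_ne (ne_of_mem_of_not_mem hj hz) _ _

theorem restrict_comp_update {J : Finset ι} {z : ι} (hz : z ∉ J) (y : (ι → α) → α) :
    (J.restrict ∘ fun f => Function.update f z (y f)) = J.restrict :=
  funext fun _ => funext fun j => Function.update_of_ne (ne_of_mem_of_not_mem j.2 hz) _ _

theorem AgreeOn.map_update {J K : Finset ι} {z : ι} {A B : Multiset (ι → α)}
    {y : (ι → α) → α} (h : AgreeOn K A B) (hJ : J.erase z ⊆ K) (hy : DependsOn y (K : Set ι)) :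
    AgreeOn J (A.map fun f => Function.update f z (y f))
      (B.map fun f => Function.update f z (y f)) := by
  refine h.map fun j hj f f' hff' => ?_
  by_cases hjz : j = z
  · subst hjz
    simpa using hy hff'
  · simpa [hjz] using hff' j (hJ (mem_erase.2 ⟨hjz, hj⟩))

/-- On the columns in `S`, the arrays with rows `id ::ₘ N` and `P` form an alphabet reduction pair
of strength `k` in which the rows of `P` involve at most `k` symbols. That those of `N` involve at
most `k + 1` symbols, the base point `o` included, makes it possible to add columns. -/
structure IsReduction (o : ι) (S : Finset ι) (k : ℕ) (P N : Multiset (ι → ι)) : Prop where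
  card_image_le : ∀ f ∈ P, #(S.image f) ≤ k
  card_insert_image_le : ∀ f ∈ N, #(insert o (S.image f)) ≤ k + 1
  agreeOn : ∀ J ⊆ S, #J ≤ k → AgreeOn J (id ::ₘ N) P

namespace IsReduction

variable {o z : ι} {S : Finset ι} {k : ℕ} {P₀ N₀ P₁ N₁ : Multiset (ι → ι)}

theorem of_card_eq (hS : #S = k) : IsReduction o S k {id} 0 where
  card_image_le f hf := by simpa [Multiset.mem_singleton.1 hf] using hS.le
  card_insert_image_le := by simp
  agreeOn _ _ _ := rfl

/-- Column `z` repeats column `o` in the pair of strength `k + 1`. This turns the row `id` into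
`update id z o`, which is then exchanged for `id` by two opposite copies of the pair of strength
`k`, with `z` and `o` respectively in column `z`. -/
theorem agreeOn_update (ho : o ∈ S)
    (h₁ : IsReduction o S (k + 1) P₁ N₁)
    (h₀ : ∀ J ⊆ S, #J ≤ k → AgreeOn J (id ::ₘ N₀) P₀)
    {J : Finset ι} (hJ : J ⊆ insert z S) (hJk : #J ≤ k + 1) :
    AgreeOn J
      (id ::ₘ (N₁.map (fun f => Function.update f z (f o)) + N₀.map (Function.update · z z) +
        P₀.map (Function.update · z o)))
      (P₁.map (fun f => Function.update f z (f o)) + P₀.map (Function.update · z z) +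
        N₀.map (Function.update · z o)) := by
  by_cases hzJ : z ∈ J
  · have herase : J.erase z ⊆ S := subset_insert_iff.1 hJ
    have hcard : #(J.erase z) ≤ k := by
      have := card_erase_add_one hzJ
      lia
    have hcopy := (h₁.agreeOn (insert o (J.erase z)) (insert_subset ho herase)
      ((card_insert_le _ _).trans (Nat.succ_le_succ hcard))).map_update (J := J) (y := (· o))
      (subset_insert _ _) fun f f' hff' => hff' o (by simp)
    have hconst (c : ι) := (h₀ _ herase hcard).map_update (J := J) (y := fun _ => c)
      Subset.rfl fun _ _ _ => rfl
    have hsum := (hcopy.add (hconst z)).add (hconst o).symm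
    have hid : Function.update id z z = id := Function.update_eq_self z id
    simp only [← Multiset.singleton_add, Multiset.map_add, Multiset.map_singleton, id_eq,
      hid] at hsum ⊢
    refine AgreeOn.add_left_cancel (C := {Function.update id z o}) ?_
    convert hsum using 1 <;> abel
  · have hrow := h₁.agreeOn J ((subset_insert_iff_of_notMem hzJ).1 hJ) hJk
    simp only [AgreeOn, Multiset.map_cons, Multiset.map_add, Multiset.map_map] at hrow ⊢
    rw [restrict_comp_update hzJ (· o), restrict_comp_update hzJ fun _ => z,
      restrict_comp_update hzJ fun _ => o, ← hrow]
    simp only [← Multiset.singleton_add]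
    abel

theorem insert_column (hz : z ∉ S) (ho : o ∈ S) (h₁ : IsReduction o S (k + 1) P₁ N₁)
    (hP₀ : ∀ f ∈ P₀, #(insert z (S.image f)) ≤ k + 1)
    (hN₀ : ∀ f ∈ N₀, #(insert o (S.image f)) ≤ k + 1)
    (h₀ : ∀ J ⊆ S, #J ≤ k → AgreeOn J (id ::ₘ N₀) P₀) :
    IsReduction o (insert z S) (k + 1)
      (P₁.map (fun f => Function.update f z (f o)) + P₀.map (Function.update · z z) +
        N₀.map (Function.update · z o))
      (N₁.map (fun f => Function.update f z (f o)) + N₀.map (Function.update · z z) +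
        P₀.map (Function.update · z o)) where
  card_image_le := by
    simp only [Multiset.mem_add, Multiset.mem_map]
    rintro _ ((⟨f, hf, rfl⟩ | ⟨f, hf, rfl⟩) | ⟨f, hf, rfl⟩) <;> rw [image_insert_update hz]
    · rw [insert_eq_self.2 (mem_image_of_mem f ho)]
      exact h₁.card_image_le f hf
    · exact hP₀ f hf
    · exact hN₀ f hf
  card_insert_image_le := by
    simp only [Multiset.mem_add, Multiset.mem_map]
    rintro _ ((⟨f, hf, rfl⟩ | ⟨f, hf, rfl⟩) | ⟨f, hf, rfl⟩) <;> rw [image_insert_update hz]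
    · rw [insert_eq_self.2 (mem_image_of_mem f ho)]
      exact h₁.card_insert_image_le f hf
    · rw [insert_comm]
      exact (card_insert_le _ _).trans (Nat.succ_le_succ (hN₀ f hf))
    · rw [insert_idem]
      exact (card_insert_le _ _).trans (Nat.succ_le_succ
        ((card_le_card (subset_insert z _)).trans (hP₀ f hf)))
  agreeOn _ hJ hJk := agreeOn_update ho h₁ h₀ hJ hJk

/-- At strength `0` there is no `IsReduction`, as the rows of `P` would have no symbol at all, but
the weaker requirements of `insert_column` can still be met. -/
theorem exists_lower_strength (z : ι)
    (h : ∀ l < k, ∃ P N, IsReduction o S (l + 1) P N ∧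
      2 * Multiset.card P = 1 + lebesgueSum #S (l + 1)) :
    ∃ P N : Multiset (ι → ι), (∀ f ∈ P, #(insert z (S.image f)) ≤ k + 1) ∧
      (∀ f ∈ N, #(insert o (S.image f)) ≤ k + 1) ∧
      (∀ J ⊆ S, #J ≤ k → AgreeOn J (id ::ₘ N) P) ∧
      2 * Multiset.card P = 1 + lebesgueSum #S k := by
  cases k with
  | zero =>
    refine ⟨{fun _ => z}, 0, fun f hf => ?_, by simp, fun J _ hJ => ?_, ?_⟩
    · rw [Multiset.mem_singleton.1 hf, zero_add]
      exact card_le_one.2 (by simp)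
    · rw [card_eq_zero.1 (Nat.le_zero.1 hJ)]
      simp [AgreeOn, funext_iff]
    · simp [lebesgueSum_zero_right]
  | succ k =>
    obtain ⟨P, N, hPN, hcard⟩ := h k k.lt_succ_self
    exact ⟨P, N, fun f hf => (card_insert_le _ _).trans (Nat.succ_le_succ (hPN.card_image_le f hf)),
      hPN.card_insert_image_le, hPN.agreeOn, hcard⟩

theorem exists_insert (S : Finset ι) (ho : o ∉ S) (hk : k ≤ #S) :
    ∃ P N, IsReduction o (insert o S) (k + 1) P N ∧
      2 * Multiset.card P = 1 + lebesgueSum (#S + 1) (k + 1) := by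
  induction S using Finset.induction_on generalizing k with
  | empty =>
    obtain rfl : k = 0 := by simpa using hk
    exact ⟨{id}, 0, of_card_eq (by simp), by simp [lebesgueSum_self]⟩
  | insert z S hz ih =>
    rw [mem_insert, not_or] at ho
    have hzS : z ∉ insert o S := by simp [Ne.symm ho.1, hz]
    have hcardS : #(insert o S) = #S + 1 := card_insert_of_notMem ho.2
    rw [card_insert_of_notMem hz] at hk ⊢
    rw [insert_comm]
    obtain rfl | hk := hk.eq_or_lt
    · refine ⟨{id}, 0, of_card_eq ?_, by simp [lebesgueSum_self]⟩
      rw [card_insert_of_notMem hzS, hcardS]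
    obtain ⟨P₁, N₁, h₁, hcard₁⟩ := ih ho.2 (Nat.le_of_lt_succ hk)
    obtain ⟨P₀, N₀, hP₀, hN₀, h₀, hcard₀⟩ := exists_lower_strength (o := o) (S := insert o S)
      (k := k) z fun l hl => by simpa only [hcardS] using ih ho.2 (by lia : l ≤ #S)
    refine ⟨_, _, h₁.insert_column hzS (mem_insert_self o S) hP₀ hN₀ h₀, ?_⟩
    have hrec := lebesgueSum_succ_succ hk
    have hN₀card := (h₀ ∅ (empty_subset _) (by simp)).card_eq
    rw [Multiset.card_cons] at hN₀card
    rw [hcardS] at hcard₀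
    simp only [Multiset.card_add, Multiset.card_map]
    lia

end IsReduction

theorem exists_mem_arpaRatios_self {k q : ℕ} (hk : 0 < k) (hkq : k ≤ q) :
    ∃ x ∈ arpaRatios q k k, 2 / (1 + lebesgueSum q k : ℝ) ≤ x := by
  obtain ⟨k, rfl⟩ := Nat.exists_eq_add_one.2 hk
  obtain ⟨n, rfl⟩ := Nat.exists_eq_add_one.2 (hk.trans_le hkq)
  obtain ⟨P, N, hPN, hcard⟩ := IsReduction.exists_insert (k := k) (univ.erase (0 : Fin (n + 1)))
    (notMem_erase _ _) (by simpa using hkq)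
  rw [insert_erase (mem_univ _)] at hPN
  simp only [card_erase_of_mem (mem_univ _), card_fin, Nat.add_sub_cancel] at hcard
  refine ⟨_, ratio_mem_arpaRatios_of_multiset (Multiset.mem_cons_self id N) hPN.card_image_le
    fun J hJ => hPN.agreeOn J (subset_univ J) hJ.le, ?_⟩
  have hcard' : (1 + lebesgueSum (n + 1) (k + 1) : ℝ) = 2 * Multiset.card P := by
    exact_mod_cast hcard.symm
  rw [hcard', div_mul_eq_div_div, div_self two_ne_zero]
  gcongr
  simp

end StrengthEqualsSymbols

section PermutationAverage

open scoped Pointwise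

variable {α : Type*} [Fintype α] [DecidableEq α]

/-- The number of permutations `σ` such that `J ⊆ σ • U` depends on `#J` only, as `Equiv.Perm α`
acts transitively on the sets of given cardinality. -/
theorem choose_mul_card_subset_smul (J U : Finset α) :
    (Fintype.card α).choose #J * #{σ : Equiv.Perm α | J ⊆ σ • U} =
      Fintype.card (Equiv.Perm α) * (#U).choose #J := by
  have hJ {K : Finset α} (hK : K ∈ powersetCard #J univ) :
      #{σ : Equiv.Perm α | K ⊆ σ • U} = #{σ : Equiv.Perm α | J ⊆ σ • U} := by
    obtain ⟨τ, hτ⟩ := (Set.powersetCard.isPretransitive (α := α) (n := #J)).exists_smul_eq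
      ⟨J, rfl⟩ ⟨K, (mem_powersetCard.1 hK).2⟩
    obtain rfl : τ • J = K := congrArg Subtype.val hτ
    refine card_equiv (Equiv.mulLeft τ⁻¹) fun σ => ?_
    simp [mul_smul, ← smul_finset_subset_iff]
  calc (Fintype.card α).choose #J * #{σ : Equiv.Perm α | J ⊆ σ • U}
      = ∑ K ∈ powersetCard #J univ, #{σ : Equiv.Perm α | K ⊆ σ • U} := by
        rw [sum_congr rfl fun K hK => hJ hK, sum_const, card_powersetCard, card_univ, smul_eq_mul]
    _ = ∑ σ : Equiv.Perm α, #{K ∈ powersetCard #J univ | K ⊆ σ • U} :=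
        sum_card_bipartiteAbove_eq_sum_card_bipartiteBelow _
    _ = ∑ σ : Equiv.Perm α, #(powersetCard #J (σ • U)) := by
        congr! with σ
        ext K
        simp [mem_powersetCard, and_comm]
    _ = Fintype.card (Equiv.Perm α) * (#U).choose #J := by
        simp [card_powersetCard, card_smul_finset]

end PermutationAverage

section StrengthTwo

open scoped Pointwise

section Rows

variable {ι : Type*} [DecidableEq ι] {o c : ι} {A B W U : Finset ι}

theorem sum_map_sum {κ α β : Type*} [AddCommMonoid β] (s : Finset κ) (M : κ → Multiset α)
    (g : α → β) : ((∑ i ∈ s, M i).map g).sum = ∑ i ∈ s, ((M i).map g).sum :=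
  map_sum (Multiset.sumAddMonoidHom.comp (Multiset.mapAddMonoidHom g)) M s

theorem AgreeOn.pair_of_sum_eq {s t : ι} {Q P : Multiset (ι → ι)}
    (h : ∀ φ : ι → ι → ℚ, (Q.map fun f => φ (f s) (f t)).sum = (P.map fun f => φ (f s) (f t)).sum) :
    AgreeOn {s, t} Q P := by
  have hrestrict : restrict {s, t} =
      (fun x (j : ({s, t} : Finset ι)) => if ↑j = s then x.1 else x.2) ∘
        fun f : ι → ι => (f s, f t) := by
    ext f ⟨j, hj⟩
    obtain rfl | rfl := (by simpa using hj : j = s ∨ j = t) <;>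
      simp +contextual
  have hcount (x : ι × ι) (M : Multiset (ι → ι)) : ((M.map fun f => (f s, f t)).count x : ℚ) =
      (M.map fun f => if x = (f s, f t) then 1 else 0).sum := by
    induction M using Multiset.induction with
    | empty => simp
    | cons f M ih =>
      rw [Multiset.map_cons, Multiset.count_cons, Multiset.map_cons, Multiset.sum_cons, ← ih,
        add_comm]
      push_cast
      rfl
  rw [AgreeOn, hrestrict, ← Multiset.map_map, ← Multiset.map_map]
  congr 1
  ext x
  rw [← Nat.cast_inj (R := ℚ), hcount, hcount]
  exact h fun y z => if x = (y, z) then 1 else 0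

/-- The coefficient of the interaction of the two variables of `φ` with respect to the base point
`o`: it vanishes when `s` or `t` is `o`. -/
def mixedDifference (o : ι) (φ : ι → ι → ℚ) (s t : ι) : ℚ :=
  φ s t - φ s o - φ o t + φ o o

theorem mixedDifference_eq_zero {φ : ι → ι → ℚ} {s t : ι} (ho : o ∈ ({s, t} : Finset ι)) :
    mixedDifference o φ s t = 0 := by
  rw [mem_insert, mem_singleton] at ho
  obtain rfl | rfl := ho <;> simp [mixedDifference]

/-- The row that keeps the symbols of the columns in `U`, and is `o` elsewhere. -/
def keepRow (o : ι) (U : Finset ι) : ι → ι := U.piecewise id fun _ => o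

/-- The row that is `o` on the columns in `W`, and `c` elsewhere. -/
def splitRow (o : ι) (W : Finset ι) (c : ι) : ι → ι := W.piecewise (fun _ => o) fun _ => c

theorem card_image_keepRow_le [Fintype ι] : #(univ.image (keepRow o U)) ≤ #U + 1 := by
  refine (card_le_card (image_subset_iff.2 fun j _ => ?_)).trans (card_insert_le o U)
  by_cases hj : j ∈ U <;> simp [keepRow, hj]

theorem card_image_splitRow_le [Fintype ι] : #(univ.image (splitRow o W c)) ≤ 2 := by
  refine (card_le_card (image_subset_iff.2 fun j _ => ?_)).trans (card_le_two (a := o) (b := c))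
  by_cases hj : j ∈ W <;> simp [splitRow, hj]

theorem card_image_piecewise_splitRow_le [Fintype ι] (hc : c ∈ W) :
    #(univ.image (W.piecewise id (splitRow o W c))) ≤ #W := by
  refine card_le_card (image_subset_iff.2 fun j _ => ?_)
  by_cases hj : j ∈ W <;> simp [splitRow, hj, hc]

theorem apply_keepRow (φ : ι → ι → ℚ) (s t : ι) :
    φ (keepRow o U s) (keepRow o U t) = φ o o +
      (φ s o - φ o o) * (if {s} ⊆ U then 1 else 0) +
      (φ o t - φ o o) * (if {t} ⊆ U then 1 else 0) +
      mixedDifference o φ s t * (if {s, t} ⊆ U then 1 else 0) := by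
  by_cases hs : s ∈ U <;> by_cases ht : t ∈ U <;>
    simp [keepRow, mixedDifference, insert_subset_iff, hs, ht]
  ring

theorem apply_piecewise_splitRow (hAB : Disjoint A B) (φ : ι → ι → ℚ) (s t : ι) :
    let split := splitRow o (A ∪ B) c
    φ ((A ∪ B).piecewise id split s) ((A ∪ B).piecewise id split t) + φ (split s) (split t) -
        φ (A.piecewise id split s) (A.piecewise id split t) -
        φ (B.piecewise id split s) (B.piecewise id split t) =
      mixedDifference o φ s t * ((if {s, t} ⊆ A ∪ B then 1 else 0) -
        (if {s, t} ⊆ A then 1 else 0) - if {s, t} ⊆ B then 1 else 0) := by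
  have hcase (j : ι) : j ∈ A ∧ j ∉ B ∨ j ∉ A ∧ j ∈ B ∨ j ∉ A ∧ j ∉ B := by
    have hj : j ∈ A → j ∉ B := fun hA => disjoint_left.1 hAB hA
    tauto
  obtain ⟨hs, hs'⟩ | ⟨hs, hs'⟩ | ⟨hs, hs'⟩ := hcase s <;>
  obtain ⟨ht, ht'⟩ | ⟨ht, ht'⟩ | ⟨ht, ht'⟩ := hcase t <;>
  simp [splitRow, mixedDifference, insert_subset_iff, hs, hs', ht, ht'] <;> ring

/-- The rows of `Q` in the pair of strength `2` on `#A + #B + e` columns, before averaging over the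
choice of `A`, `B` and `c`. The multiplicities are those for which the average interaction of two
columns, measured by `mixedDifference`, is the same as in `reducedRows`. -/
def sourceRows (o : ι) (e : ℕ) (A B : Finset ι) (c : ι) : Multiset (ι → ι) :=
  (2 * #A * #B) • {id} + (2 * #A * e) • {keepRow o (A.erase c)} +
    ((#B + e) * e) • ({A.piecewise id (splitRow o (A ∪ B) c)} +
      {B.piecewise id (splitRow o (A ∪ B) c)})

/-- The rows of `P`, see `sourceRows`. -/
def reducedRows (o : ι) (e : ℕ) (A B : Finset ι) (c : ι) : Multiset (ι → ι) :=
  (2 * #A * (#B + e)) • {keepRow o ((A ∪ B).erase c)} +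
    ((#B + e) * e) • ({(A ∪ B).piecewise id (splitRow o (A ∪ B) c)} + {splitRow o (A ∪ B) c})

theorem le_count_id_sourceRows (o : ι) (e : ℕ) (A B : Finset ι) (c : ι) [DecidableEq (ι → ι)] :
    2 * #A * #B ≤ (sourceRows o e A B c).count id := by
  rw [sourceRows, Multiset.count_add, Multiset.count_add, Multiset.count_nsmul,
    Multiset.count_singleton_self]
  lia

theorem card_reducedRows (o : ι) (e : ℕ) (A B : Finset ι) (c : ι) :
    Multiset.card (reducedRows o e A B c) = 2 * (#A + e) * (#B + e) := by
  simp only [reducedRows, Multiset.card_add, Multiset.card_nsmul, Multiset.card_singleton]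
  ring

theorem card_image_le_of_mem_reducedRows [Fintype ι] {e : ℕ} (hAB : Disjoint A B) (hc : c ∈ A)
    (hB : B.Nonempty) {f : ι → ι} (hf : f ∈ reducedRows o e A B c) :
    #(univ.image f) ≤ #A + #B := by
  have hcW : c ∈ A ∪ B := mem_union_left B hc
  simp only [reducedRows, Multiset.mem_add, Multiset.mem_nsmul, Multiset.mem_singleton] at hf
  rw [← card_union_of_disjoint hAB]
  obtain ⟨-, rfl⟩ | ⟨-, rfl | rfl⟩ := hf
  · exact card_image_keepRow_le.trans_eq (card_erase_add_one hcW)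
  · exact card_image_piecewise_splitRow_le hcW
  · refine card_image_splitRow_le.trans ?_
    rw [card_union_of_disjoint hAB]
    exact Nat.add_le_add (card_pos.2 ⟨c, hc⟩) hB.card_pos

theorem sum_map_sourceRows_sub_reducedRows {e : ℕ} (hAB : Disjoint A B) (φ : ι → ι → ℚ) (s t : ι) :
    ((sourceRows o e A B c).map fun f => φ (f s) (f t)).sum -
        ((reducedRows o e A B c).map fun f => φ (f s) (f t)).sum =
      2 * #A * #B * φ s t +
        2 * #A * e * φ (keepRow o (A.erase c) s) (keepRow o (A.erase c) t) -
        2 * #A * (#B + e) * φ (keepRow o ((A ∪ B).erase c) s) (keepRow o ((A ∪ B).erase c) t) -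
        (#B + e) * e * (mixedDifference o φ s t * ((if {s, t} ⊆ A ∪ B then 1 else 0) -
          (if {s, t} ⊆ A then 1 else 0) - if {s, t} ⊆ B then 1 else 0)) := by
  rw [← apply_piecewise_splitRow hAB (c := c)]
  simp only [sourceRows, reducedRows, Multiset.map_add, Multiset.map_nsmul, Multiset.sum_add,
    Multiset.sum_nsmul, Multiset.map_singleton, Multiset.sum_singleton, nsmul_eq_mul, id_eq]
  push_cast
  ring

end Rows

variable {n : ℕ} {A B : Finset (Fin n)} {c : Fin n}

/-- The set of columns other than `0` that corresponds to `U` after a permutation. -/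
def columnSet (σ : Equiv.Perm (Fin n)) (U : Finset (Fin n)) : Finset (Fin (n + 1)) :=
  U.map (σ.toEmbedding.trans (Fin.succEmb n))

theorem card_columnSet (σ : Equiv.Perm (Fin n)) (U : Finset (Fin n)) : #(columnSet σ U) = #U :=
  card_map _

theorem disjoint_columnSet {σ : Equiv.Perm (Fin n)} :
    Disjoint (columnSet σ A) (columnSet σ B) ↔ Disjoint A B :=
  disjoint_map _

theorem columnSet_union (σ : Equiv.Perm (Fin n)) (A B : Finset (Fin n)) :
    columnSet σ A ∪ columnSet σ B = columnSet σ (A ∪ B) :=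
  (map_union _ _).symm

theorem columnSet_erase (σ : Equiv.Perm (Fin n)) (U : Finset (Fin n)) (c : Fin n) :
    (columnSet σ U).erase (σ c).succ = columnSet σ (U.erase c) :=
  (map_erase (σ.toEmbedding.trans (Fin.succEmb n)) U c).symm

theorem succ_mem_columnSet (σ : Equiv.Perm (Fin n)) (hc : c ∈ A) : (σ c).succ ∈ columnSet σ A :=
  mem_map_of_mem (σ.toEmbedding.trans (Fin.succEmb n)) hc

/-- No `columnSet σ U` contains the column `0`, but the right-hand side does not see this: the
factor `x` must vanish there. -/
theorem sum_mul_ite_subset_columnSet (U : Finset (Fin n)) (J : Finset (Fin (n + 1))) {x : ℚ}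
    (hx : 0 ∈ J → x = 0) :
    ∑ σ, x * (if J ⊆ columnSet σ U then 1 else 0) =
      Fintype.card (Equiv.Perm (Fin n)) * (x * ((#U).choose #J / n.choose #J)) := by
  by_cases h0 : 0 ∈ J
  · simp [hx h0]
  obtain ⟨J, rfl⟩ : ∃ I : Finset (Fin n), I.map (Fin.succEmb n) = J := by
    obtain ⟨I, -, rfl⟩ := subset_map_iff.1 (show J ⊆ univ.map (Fin.succEmb n) from fun j hj => by
      simpa using ne_of_mem_of_not_mem hj h0)
    exact ⟨I, rfl⟩
  have hcount := choose_mul_card_subset_smul J U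
  have hsub (σ : Equiv.Perm (Fin n)) :
      J.map (Fin.succEmb n) ⊆ columnSet σ U ↔ J ⊆ σ • U := by
    rw [columnSet, ← map_map, map_subset_map, map_eq_image]
    rfl
  have hpos : 0 < n.choose #J := Nat.choose_pos (by simpa using card_le_univ J)
  simp only [hsub, ← mul_sum, sum_boole, card_map]
  rw [Fintype.card_fin] at hcount
  rw [mul_left_comm]
  congr 1
  rw [← mul_div_assoc, eq_div_iff (by exact_mod_cast hpos.ne'), mul_comm]
  exact_mod_cast hcount

theorem sum_apply_keepRow (U : Finset (Fin n)) (φ : Fin (n + 1) → Fin (n + 1) → ℚ)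
    {s t : Fin (n + 1)} (hst : s ≠ t) :
    ∑ σ, φ (keepRow 0 (columnSet σ U) s) (keepRow 0 (columnSet σ U) t) =
      Fintype.card (Equiv.Perm (Fin n)) * (φ 0 0 + (φ s 0 + φ 0 t - 2 * φ 0 0) * (#U / n) +
        mixedDifference 0 φ s t * ((#U).choose 2 / n.choose 2)) := by
  simp only [apply_keepRow, sum_add_distrib, sum_const, card_univ, nsmul_eq_mul]
  rw [sum_mul_ite_subset_columnSet, sum_mul_ite_subset_columnSet, sum_mul_ite_subset_columnSet,
    card_pair hst, card_singleton, card_singleton, Nat.choose_one_right, Nat.choose_one_right]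
  · ring
  · exact mixedDifference_eq_zero
  all_goals
    intro h
    rw [← mem_singleton.1 h, sub_self]

theorem agreeOn_sum_sourceRows_reducedRows {e : ℕ} (hAB : Disjoint A B) (hc : c ∈ A)
    (hn : #A + #B + e = n + 1) (hn2 : 2 ≤ n) {s t : Fin (n + 1)} (hst : s ≠ t) :
    AgreeOn {s, t} (∑ σ, sourceRows 0 e (columnSet σ A) (columnSet σ B) (σ c).succ)
      (∑ σ, reducedRows 0 e (columnSet σ A) (columnSet σ B) (σ c).succ) := by
  refine AgreeOn.pair_of_sum_eq fun φ => ?_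
  have hpair : 0 ∈ ({s, t} : Finset (Fin (n + 1))) → mixedDifference 0 φ s t = 0 :=
    mixedDifference_eq_zero
  rw [← sub_eq_zero, sum_map_sum, sum_map_sum, ← sum_sub_distrib]
  simp only [sum_map_sourceRows_sub_reducedRows (disjoint_columnSet.2 hAB), columnSet_erase,
    columnSet_union, card_columnSet]
  simp only [mul_sub, sum_sub_distrib, sum_add_distrib, ← mul_sum, sum_apply_keepRow _ φ hst,
    sum_mul_ite_subset_columnSet _ _ hpair, card_pair hst, sum_const, card_univ, nsmul_eq_mul]
  have hAc : (#(A.erase c) : ℚ) = #A - 1 := by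
    rw [card_erase_of_mem hc, Nat.cast_pred (card_pos.2 ⟨c, hc⟩)]
  have hABc : (#((A ∪ B).erase c) : ℚ) = #A + #B - 1 := by
    have hc' := mem_union_left B hc
    rw [card_erase_of_mem hc', Nat.cast_pred (card_pos.2 ⟨c, hc'⟩), card_union_of_disjoint hAB,
      Nat.cast_add]
  have he : (n : ℚ) = #A + #B + e - 1 := by
    rw [eq_sub_iff_add_eq]
    exact_mod_cast hn.symm
  have hn0 : (n : ℚ) ≠ 0 := by positivity
  have hn1 : (n : ℚ) - 1 ≠ 0 := sub_ne_zero.2 (by exact_mod_cast (by lia : n ≠ 1))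
  simp only [Nat.cast_choose_two, hAc, hABc, card_union_of_disjoint hAB, Nat.cast_add]
  simp only [mixedDifference]
  field_simp
  rw [he]
  ring

theorem exists_mem_arpaRatios_two {q a b : ℕ} (ha : 0 < a) (hb : 0 < b) (hq : a + b < q) :
    ∃ x ∈ arpaRatios q (a + b) 2, ((a : ℝ) * b) / (((q : ℝ) - a) * (q - b)) ≤ x := by
  obtain ⟨e, he, hn⟩ : ∃ e, 0 < e ∧ a + b + e = q := ⟨q - (a + b), by lia, by lia⟩
  obtain ⟨n, rfl⟩ : ∃ n, q = n + 1 := ⟨q - 1, by lia⟩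
  obtain ⟨A, -, rfl⟩ := exists_subset_card_eq (s := (univ : Finset (Fin n))) (n := a)
    (by rw [card_fin]; lia)
  obtain ⟨B, hBA, rfl⟩ := exists_subset_card_eq (s := Aᶜ) (n := b)
    (by rw [card_compl, Fintype.card_fin]; lia)
  have hAB : Disjoint A B := (disjoint_compl_right.mono_right hBA :)
  obtain ⟨c, hc⟩ := card_pos.1 ha
  set N := Fintype.card (Equiv.Perm (Fin n)) with hN
  set Q := ∑ σ, sourceRows 0 e (columnSet σ A) (columnSet σ B) (σ c).succ with hQ
  set P := ∑ σ, reducedRows 0 e (columnSet σ A) (columnSet σ B) (σ c).succ with hP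
  have hcount : N * (2 * #A * #B) ≤ Q.count id := by
    rw [hQ, Multiset.count_sum', hN, ← card_univ, ← smul_eq_mul]
    refine card_nsmul_le_sum _ _ _ fun σ _ => ?_
    simpa only [card_columnSet] using
      le_count_id_sourceRows 0 e (columnSet σ A) (columnSet σ B) (σ c).succ
  have hcard : Multiset.card P = N * (2 * (#A + e) * (#B + e)) := by
    rw [hP, Multiset.card_sum, hN, ← card_univ, ← smul_eq_mul, ← sum_const]
    refine sum_congr rfl fun σ _ => ?_
    rw [card_reducedRows, card_columnSet, card_columnSet]
  have hpos : 0 < N := Fintype.card_pos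
  refine ⟨_, ratio_mem_arpaRatios_of_multiset
    (Multiset.count_pos.1 ((by positivity : 0 < _).trans_le hcount)) (P := P) (fun f hf => ?_)
    fun J hJ => ?_, ?_⟩
  · obtain ⟨σ, -, hf⟩ := Multiset.mem_sum.1 hf
    simpa only [card_columnSet] using card_image_le_of_mem_reducedRows (disjoint_columnSet.2 hAB)
      (succ_mem_columnSet σ hc) (card_pos.1 ((card_columnSet σ B).symm ▸ hb)) hf
  · obtain ⟨s, t, hst, rfl⟩ := card_eq_two.1 hJ
    exact agreeOn_sum_sourceRows_reducedRows hAB hc hn (by lia) hst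
  · have hcount' : (N * (2 * #A * #B) : ℝ) ≤ Q.count id := by exact_mod_cast hcount
    have hqa : ((n + 1 : ℕ) : ℝ) - #A = #B + e := by rw [← hn]; push_cast; ring
    have hqb : ((n + 1 : ℕ) : ℝ) - #B = #A + e := by rw [← hn]; push_cast; ring
    rw [hcard, hqa, hqb]
    refine le_trans (le_of_eq ?_) (div_le_div_of_nonneg_right hcount' (Nat.cast_nonneg _))
    push_cast
    field_simp

end StrengthTwo

theorem isGreatest_ratios_two {p q : ℕ} (hp : 2 ≤ p) (hpq : p < q) :
    IsGreatest (arpaRatios q p 2) (((⌈(p : ℝ) / 2⌉ : ℝ) * (⌊(p : ℝ) / 2⌋ : ℝ)) /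
        (((q : ℝ) - (⌈(p : ℝ) / 2⌉ : ℝ)) * ((q : ℝ) - (⌊(p : ℝ) / 2⌋ : ℝ)))) ∧
    IsGreatest (cpaRatios q p 2) (((⌈(p : ℝ) / 2⌉ : ℝ) * (⌊(p : ℝ) / 2⌋ : ℝ)) /
        (((q : ℝ) - (⌈(p : ℝ) / 2⌉ : ℝ)) * ((q : ℝ) - (⌊(p : ℝ) / 2⌋ : ℝ)))) := by
  obtain ⟨a, b, hab, rfl⟩ : ∃ a b, (a = b ∨ a = b + 1) ∧ p = a + b :=
    ⟨(p + 1) / 2, p / 2, by omega, by omega⟩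
  have hfl : ⌊((a + b : ℕ) : ℝ) / 2⌋ = b := by
    rw [Int.floor_eq_iff]
    rcases hab with rfl | rfl <;> push_cast <;> constructor <;> linarith
  have hce : ⌈((a + b : ℕ) : ℝ) / 2⌉ = a := by
    rw [Int.ceil_eq_iff]
    rcases hab with rfl | rfl <;> push_cast <;> constructor <;> linarith
  rw [hfl, hce]
  push_cast
  exact isGreatest_of_attained
    (fun x hx => le_of_mem_cpaRatios_two hab (by omega) hpq hx)
    (exists_mem_arpaRatios_two (by omega) (by omega) hpq)

theorem isGreatest_ratios_self {k q : ℕ} (hk : 0 < k) (hkq : k < q) :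
    IsGreatest (arpaRatios q k k) (2 / (1 + ∑ i ∈ Finset.range (k + 1),
        (q.choose i : ℝ) * ((q - i - 1).choose (k - i) : ℝ))) ∧
    IsGreatest (cpaRatios q k k) (2 / (1 + ∑ i ∈ Finset.range (k + 1),
        (q.choose i : ℝ) * ((q - i - 1).choose (k - i) : ℝ))) := by
  have h : ∑ i ∈ Finset.range (k + 1), (q.choose i : ℝ) * ((q - i - 1).choose (k - i) : ℝ) =
      lebesgueSum q k := by
    push_cast [lebesgueSum]
    rfl
  rw [h]
  exact isGreatest_of_attained (fun x hx => le_of_mem_cpaRatios_self hkq.le hx)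
    (exists_mem_arpaRatios_self hk hkq.le)

theorem isGreatest_ratios_one {p q : ℕ} (hp : 0 < p) (hpq : p < q) :
    IsGreatest (arpaRatios q p 1) ((p : ℝ) / q) ∧ IsGreatest (cpaRatios q p 1) ((p : ℝ) / q) :=
  isGreatest_of_attained (fun _ hx => le_of_mem_cpaRatios_one (hp.trans hpq) hx)
    (exists_mem_arpaRatios_one hp hpq.le)

theorem corollary4p8 (k p q : ℕ) (hk : 1 ≤ k) (hkp : k ≤ p) (hpq : p < q)
    (hcase : p = k ∨ k = 1 ∨ k = 2) :
    -- both suprema are attained maxima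
    IsGreatest (arpaRatios q p k) (arpaGamma q p k) ∧
    IsGreatest (cpaRatios q p k) (cpaDelta q p k) ∧
    arpaGamma q p k = cpaDelta q p k ∧
    (p = k → cpaDelta q p k =
      2 / (1 + ∑ i ∈ Finset.range (k + 1),
        (q.choose i : ℝ) * ((q - i - 1).choose (k - i) : ℝ))) ∧
    (k = 1 → cpaDelta q p k = (p : ℝ) / (q : ℝ)) ∧
    (k = 2 → cpaDelta q p k =
      ((⌈(p : ℝ) / 2⌉ : ℝ) * (⌊(p : ℝ) / 2⌋ : ℝ)) /
        (((q : ℝ) - (⌈(p : ℝ) / 2⌉ : ℝ)) * ((q : ℝ) - (⌊(p : ℝ) / 2⌋ : ℝ)))) := by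
  obtain ⟨V, hγ, hδ⟩ : ∃ V, IsGreatest (arpaRatios q p k) V ∧ IsGreatest (cpaRatios q p k) V := by
    rcases hcase with rfl | rfl | rfl
    · exact ⟨_, isGreatest_ratios_self hk hpq⟩
    · exact ⟨_, isGreatest_ratios_one hkp hpq⟩
    · exact ⟨_, isGreatest_ratios_two hkp hpq⟩
  have eγ : arpaGamma q p k = V := hγ.csSup_eq
  have eδ : cpaDelta q p k = V := hδ.csSup_eq
  rw [eγ, eδ]
  refine ⟨hγ, hδ, rfl, ?_, ?_, ?_⟩
  · rintro rfl
    exact hδ.unique (isGreatest_ratios_self hk hpq).2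
  · rintro rfl
    exact hδ.unique (isGreatest_ratios_one hkp hpq).2
  · rintro rfl
    exact hδ.unique (isGreatest_ratios_two hkp hpq).2
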